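/- Let $N\ge 1$. Consider the circular ensemble with $\beta=4$ (that is, $\kappa=\beta/2=2$): $N$ particles $\zeta_j=e^{i\theta_j}$ on the unit circle with joint density, with respect to $\prod_j \frac{d\theta_j}{2\pi}$, $$\frac{1}{Z_N}\prod_{1\le j<k\le N}|e^{i\theta_j}-e^{i\theta_k}|^{4},\qquad Z_N=\int_{[0,2\pi]^N}\prod_{1\le j<k\le N}|e^{i\theta_j}-e^{i\theta_k}|^{4}\prod_{j=1}^N\frac{d\theta_j}{2\pi}.$$ Let $$\rho_{(n)}(\theta_1,\dots,\theta_n)=\frac{N(N-1)\cdots(N-n+1)}{Z_N}\int_{[0,2\pi]^{N-n}}\prod_{1\le j<k\le N}|e^{i\theta_j}-e^{i\theta_k}|^{4}\prod_{j=n+1}^N\frac{d\theta_j}{2\pi}$$ for $n=1,2$ (with $\rho_{(2)}=0$ if $N=1$), let $\rho_{(2)C}(\theta_1,\theta_2)=\rho_{(2)}(\theta_1,\theta_2)-\rho_{(1)}(\theta_1)\rho_{(1)}(\theta_2)$, and let $$m_k=\int_0^{2\pi}\rho_{(2)C}(0,\theta)\,e^{-ik\theta}\,\frac{d\theta}{2\pi}\qquad(k\in\mathbb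 Z).$$ Then $\rho_{(2)C}(\theta_1,\theta_2)=\sum_{k\in\mathbb Z}m_k e^{ik(\theta_2-\theta_1)}$ for all real $\theta_1,\theta_2$, and the following hold, where $\psi=\Gamma'/\Gamma$ is the digamma function. 1. For every integer $k$ with $|k|\le 2N-2$, $$m_k=-\tfrac12\begin{cases}2N-k-\tfrac12 k\left[\psi(N+\tfrac12)-\psi(-N+k+\tfrac12)\right], & k>0,\\ 2N+k-\tfrac12 k\left[\psi(N+k+\tfrac12)-\psi(-N+\tfrac12)\right], & k\le 0.\end{cases}$$ 2. For every integer $k$ with $0<k\le 2N-2$, $$m_k=-N+\frac k2+\frac k2\sum_{j=1}^{k}\frac{1}{2N-2j+1}.$$ 3. For every integer $k$ with $|k|\ge 2N-1$, $m_k=0$. -/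

import Mathlib

open MeasureTheory

noncomputable section

namespace CircularEnsemble

/-- The normalised rotation-invariant measure `dζ / (2πiζ) = dθ / (2π)` on the unit circle,
written in the angle variable `θ ∈ (0, 2π]`, `ζ = e^{iθ}`. -/
def angleMeasure : Measure ℝ :=
  ENNReal.ofReal (2 * Real.pi)⁻¹ • (volume.restrict (Set.Ioc 0 (2 * Real.pi)))

/-- The unnormalised eigenvalue density of the Dyson circular ensemble with `β = 2κ` and `n`
particles: `∏_{j < k} |e^{iθ_j} - e^{iθ_k}|^{2κ}`. -/
def weight (κ : ℝ) {n : ℕ} (θ : Fin n → ℝ) : ℝ :=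
  ∏ j : Fin n, ∏ k ∈ Finset.Ioi j,
    ‖Complex.exp (Complex.I * (θ j : ℂ)) - Complex.exp (Complex.I * (θ k : ℂ))‖ ^ (2 * κ)

/-- The normalisation `Z_N`. -/
def partitionFunction (κ : ℝ) (N : ℕ) : ℝ :=
  ∫ θ : Fin N → ℝ, weight κ θ ∂(Measure.pi fun _ => angleMeasure)

/-- The `n`-point correlation function of the `N`-particle ensemble,
`ρ_{(n)}(θ_1, …, θ_n; N) = N (N-1) ⋯ (N-n+1) / Z_N * ∫ weight dθ_{n+1} ⋯ dθ_N`,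
all integrals being with respect to `dθ / (2π)`.  (For `n > N` the prefactor vanishes.) -/
def correlation (κ : ℝ) (N : ℕ) {n : ℕ} (θ : Fin n → ℝ) : ℝ :=
  (N.descFactorial n : ℝ) / partitionFunction κ N *
    ∫ φ : Fin (N - n) → ℝ, weight κ (Fin.append θ φ) ∂(Measure.pi fun _ => angleMeasure)

/-- The connected two-point correlation function
`ρ_{(2)C}(θ₁, θ₂) = ρ_{(2)}(θ₁, θ₂) - ρ_{(1)}(θ₁) ρ_{(1)}(θ₂)`. -/
def connectedTwoPoint (κ : ℝ) (N : ℕ) (θ₁ θ₂ : ℝ) : ℝ :=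
  correlation κ N ![θ₁, θ₂] - correlation κ N ![θ₁] * correlation κ N ![θ₂]

/-- The moment `m_k(N, κ)`: the `k`-th Fourier coefficient of the connected two-point correlation
function in the variable `θ = θ₂ - θ₁` (here with `θ₁ = 0`). -/
def moment (κ : ℝ) (N : ℕ) (k : ℤ) : ℂ :=
  ∫ θ : ℝ, (connectedTwoPoint κ N 0 θ : ℂ) * Complex.exp (-(Complex.I * (k : ℂ) * (θ : ℂ)))
    ∂angleMeasure

end CircularEnsemble

end

/-!
Put `z_s = e^{iθ_s}`. On the unit circle the density `∏_{s < t} |z_s - z_t| ^ 4` equals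
`∏_{s < t} (z_t - z_s) ^ 4` up to a monomial, and this is a confluent Vandermonde determinant. With
the monomial absorbed it is, up to a sign, the determinant `pairDet` of size `2N` whose rows are
`e^{i x θ_s}` and `x e^{i x θ_s}` and whose columns are the frequencies
`x = ±1/2, …, ±(N - 1/2)` (`weight_two_eq`).

Expand this determinant along the two rows of one variable and integrate over that variable. Two
columns `x`, `x'` survive only if `x + x' = 0`, so the integral is a combination of determinants of
the same kind, each without one pair of opposite frequencies (`integral_pairDet_snoc`). Iteration
expresses `Z_N` and the one- and two-point functions through determinants of sizes `0`, `2` and `4`.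
The result is `ρ_{(1)} = N` and, once the product of the one-point functions has cancelled the
constant terms, the trigonometric polynomial (`connectedTwoPoint_two`)
`ρ_{(2)C}(θ₁, θ₂) = ∑_{a, b} (a - b) ^ 2 / (8ab) e^{i (a + b) (θ₂ - θ₁)}`,
where `a` and `b` run independently over the `2N` frequencies.

Hence `m_k` is the sum of `(a - b) ^ 2 / (8ab) = (k / 4 * (1 / a + 1 / b) - 1) / 2` over the pairs
with `a + b = k`. The largest value `a + b = 2N - 1` occurs only for `a = b`, where the coefficient
vanishes. The sum of `1 / a` over an interval of half-integers is a difference of digamma values,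
and cancelling opposite frequencies turns it into the sum over odd numbers.
-/

namespace CircularEnsemble

/-! ### Determinants of confluent Vandermonde matrices -/

open Polynomial in
theorem mul_divX_of_coeff_zero {R : Type*} [CommRing R] {p : R[X]} (h : p.coeff 0 = 0) :
    X * p.divX = p := by
  have := p.X_mul_divX_add
  rwa [h, C_0, add_zero] at this

@[to_additive]
theorem prod_fin_pairs {M : Type*} [CommMonoid M] {n : ℕ} (f : Fin (2 * n) → M) :
    ∏ i, f i = ∏ s : Fin n, f ⟨2 * s, by omega⟩ * f ⟨2 * s + 1, by omega⟩ := by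
  induction n with
  | zero => rfl
  | succ n ih =>
    rw [Fin.prod_univ_castSucc (n := n), ← mul_assoc]
    refine (Fin.prod_univ_castSucc (n := 2 * n + 1) f).trans (congrArg (· * _) ?_)
    refine (Fin.prod_univ_castSucc (n := 2 * n) _).trans (congrArg (· * _) ?_)
    exact ih _

/-- The pair to which a row (or column) of a matrix of size `2n` belongs: rows `2s` and `2s + 1`
form the pair `s`. -/
def half {n : ℕ} (i : Fin (2 * n)) : Fin n := ⟨i / 2, by omega⟩

theorem half_two_mul {n : ℕ} (s : Fin n) : half (⟨2 * s, by omega⟩ : Fin (2 * n)) = s := by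
  ext; simp only [half]; omega

theorem half_two_mul_add_one {n : ℕ} (s : Fin n) :
    half (⟨2 * s + 1, by omega⟩ : Fin (2 * n)) = s := by
  ext; simp only [half]; omega

/-- The Vandermonde product of the nodes `x_0, y_0, x_1, y_1, …`, grouped by pairs. -/
theorem prod_Ioi_fin_pairs {R : Type*} [CommRing R] {n : ℕ} (u : Fin (2 * n) → R)
    (x y : Fin n → R) (hx : ∀ s : Fin n, u ⟨2 * s, by omega⟩ = x s)
    (hy : ∀ s : Fin n, u ⟨2 * s + 1, by omega⟩ = y s) :
    ∏ i, ∏ j ∈ Finset.Ioi i, (u j - u i) =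
      (∏ s, (y s - x s)) * ∏ s, ∏ t ∈ Finset.Ioi s,
        ((x t - x s) * (y t - x s) * (x t - y s) * (y t - y s)) := by
  have key : ∀ (m : ℕ) (f : Fin m → Fin m → R),
      ∏ i, ∏ j ∈ Finset.Ioi i, f i j = ∏ i, ∏ j, if i < j then f i j else 1 := by
    intro m f
    refine Finset.prod_congr rfl fun i _ => ?_
    rw [← Finset.prod_filter]
    congr 1
    ext j; simp
  rw [key, key, prod_fin_pairs, ← Finset.prod_mul_distrib]
  refine Finset.prod_congr rfl fun s _ => ?_
  rw [prod_fin_pairs, prod_fin_pairs, ← Finset.prod_mul_distrib,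
    show y s - x s = ∏ t, if t = s then y s - x s else 1 by simp, ← Finset.prod_mul_distrib]
  refine Finset.prod_congr rfl fun t _ => ?_
  simp only [hx, hy, Fin.lt_def, Fin.ext_iff]
  rcases lt_trichotomy (s : ℕ) t with h | h | h
  · rw [if_pos (by omega), if_pos (by omega), if_pos (by omega), if_pos (by omega),
      if_neg (by omega), if_pos h]
    ring
  · rw [if_neg (by omega), if_pos (by omega), if_neg (by omega), if_neg (by omega),
      if_pos (by omega), if_neg (by omega)]
    rw [Fin.ext h]
    ring
  · rw [if_neg (by omega), if_neg (by omega), if_neg (by omega), if_neg (by omega),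
      if_neg (by omega), if_neg (by omega)]
    ring

open Polynomial in
/-- The confluent Vandermonde determinant, in which the derivative rows are `(l - c) z ^ l`. It is
the part of lowest order in `X` of the Vandermonde determinant with the nodes `z_s` and `z_s (1 + X)`,
which carries the factor `X ^ n`. -/
theorem det_confluent_vandermonde {R : Type*} [CommRing R] {n : ℕ} (c : R) (z : Fin n → R) :
    (Matrix.of fun i j : Fin (2 * n) =>
      (if (i : ℕ) % 2 = 0 then 1 else ((j : ℕ) : R) - c) * z (half i) ^ (j : ℕ)).det =
      (∏ s, z s) * ∏ s, ∏ t ∈ Finset.Ioi s, (z t - z s) ^ 4 := by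
  -- `L` subtracts row `2s` of the Vandermonde matrix from `1 - c X` times row `2s + 1`; the result
  -- is divisible by `X`, and the quotient at `X = 0` is the derivative row
  let u : Fin (2 * n) → R[X] := fun i => C (z (half i)) * if (i : ℕ) % 2 = 0 then 1 else 1 + X
  let d : Fin (2 * n) → R[X] := fun i => if (i : ℕ) % 2 = 0 then 1 else 1 - C c * X
  let L : Matrix (Fin (2 * n)) (Fin (2 * n)) R[X] := fun i k =>
    (if i = k then d i else 0) + if (k : ℕ) + 1 = i ∧ (i : ℕ) % 2 = 1 then -1 else 0
  let g : ℕ → R[X] := fun l => ((1 + X) ^ l * (1 - C c * X) - 1).divX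
  let G : Matrix (Fin (2 * n)) (Fin (2 * n)) R[X] := Matrix.of fun i j =>
    (if (i : ℕ) % 2 = 0 then 1 else g j) * C (z (half i)) ^ (j : ℕ)
  have hg : ∀ l, X * g l = (1 + X) ^ l * (1 - C c * X) - 1 := fun l =>
    mul_divX_of_coeff_zero (by simp [coeff_zero_eq_eval_zero])
  have hg0 : ∀ l, (g l).eval 0 = (l : R) - c := by
    intro l
    have h1 : ((1 + X : R[X]) ^ l).coeff 0 = 1 := by simp [coeff_zero_eq_eval_zero]
    have h2 : ((1 + X : R[X]) ^ l).coeff 1 = l := by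
      rw [coeff_one_add_X_pow]; simp
    rw [← coeff_zero_eq_eval_zero, coeff_divX]
    simp [mul_sub, ← mul_assoc, coeff_mul_X, h2, coeff_one, mul_coeff_zero, h1]
  have hLV : L * Matrix.vandermonde u =
      Matrix.of fun i j : Fin (2 * n) => (if (i : ℕ) % 2 = 0 then 1 else X) * G i j := by
    ext1 i j
    rw [Matrix.mul_apply]
    simp only [L, Matrix.vandermonde_apply, add_mul, Finset.sum_add_distrib, ite_mul, zero_mul,
      Finset.sum_ite_eq, Finset.mem_univ, if_true, Matrix.of_apply, G, u, d]
    rcases Nat.mod_two_eq_zero_or_one i with h | h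
    · simp [h]
    · obtain ⟨i₀, hi₀⟩ : ∃ i₀ : Fin (2 * n), (i₀ : ℕ) + 1 = i := ⟨⟨i - 1, by omega⟩, by
        simp only; omega⟩
      have hh : half i₀ = half i := by
        ext; simp only [half]; omega
      have hk : ∀ k : Fin (2 * n), ((k : ℕ) + 1 = i ∧ (i : ℕ) % 2 = 1) ↔ k = i₀ := by
        intro k; rw [Fin.ext_iff]; omega
      have h0 : (i₀ : ℕ) % 2 = 0 := by omega
      simp only [hk, Finset.sum_ite_eq', Finset.mem_univ, if_true]
      simp only [h, h0, hh, one_ne_zero, if_true, if_false]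
      rw [← mul_assoc, hg, mul_pow]
      ring
  have hL : L.det = (1 - C c * X) ^ n := by
    rw [Matrix.det_of_isLowerTriangular]
    · rw [prod_fin_pairs]
      simp [L, d, Nat.add_mod]
    · intro i j hij
      have : i < j := hij
      simp only [L]
      rw [if_neg (by omega), if_neg (by omega), add_zero]
  have hdet := congrArg Matrix.det hLV
  rw [Matrix.det_mul, hL, Matrix.det_vandermonde, Matrix.det_mul_column,
    prod_Ioi_fin_pairs u (fun s => C (z s)) (fun s => C (z s) * (1 + X))
      (fun s => by simp [u, half_two_mul])
      (fun s => by simp [u, half_two_mul_add_one, Nat.add_mod]), prod_fin_pairs] at hdet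
  have hX : (∏ s : Fin n, (C (z s) * (1 + X) - C (z s))) = X ^ n * ∏ s, C (z s) := by
    rw [show (X : R[X]) ^ n = ∏ s : Fin n, X by simp, ← Finset.prod_mul_distrib]
    exact Finset.prod_congr rfl fun s _ => by ring
  have hX' : (∏ s : Fin n, ((if ((⟨2 * s, by omega⟩ : Fin (2 * n)) : ℕ) % 2 = 0 then 1 else X) *
      (if ((⟨2 * s + 1, by omega⟩ : Fin (2 * n)) : ℕ) % 2 = 0 then 1 else X)) : R[X]) = X ^ n := by
    simp [Nat.add_mod]
  rw [hX, hX', mul_comm, mul_assoc, mul_assoc] at hdet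
  have hG := congrArg (eval 0) ((isRegular_X_pow n).left hdet)
  have hGe : (evalRingHom (0 : R)).mapMatrix G = Matrix.of fun i j : Fin (2 * n) =>
      (if (i : ℕ) % 2 = 0 then 1 else ((j : ℕ) : R) - c) * z (half i) ^ (j : ℕ) := by
    ext i j
    simp only [RingHom.mapMatrix_apply, Matrix.map_apply, G, Matrix.of_apply, coe_evalRingHom,
      eval_mul, eval_pow, eval_C, apply_ite (eval (0 : R)), hg0, eval_one]
  rw [← hGe, ← RingHom.map_det, coe_evalRingHom, ← hG]
  simp only [eval_mul, eval_prod, eval_sub, eval_pow, eval_C, eval_add, eval_one, eval_X, add_zero,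
    mul_one, mul_zero, sub_zero, one_pow]
  congr 1
  exact Finset.prod_congr rfl fun s _ => Finset.prod_congr rfl fun t _ => by ring

open Complex

noncomputable section

/-! ### The density at `β = 4` as a confluent determinant -/

theorem prod_Ioi_mul {M : Type*} [CommMonoid M] {n : ℕ} (f : Fin n → M) :
    ∏ s, ∏ t ∈ Finset.Ioi s, (f s * f t) = ∏ s, f s ^ (n - 1) := by
  simp only [Finset.prod_mul_distrib, Finset.prod_const, Fin.card_Ioi]
  rw [Finset.prod_comm' (t' := Finset.univ) (s' := fun t => Finset.Iio t) (by simp)]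
  simp only [Finset.prod_const, Fin.card_Iio, ← Finset.prod_mul_distrib, ← pow_add]
  exact Finset.prod_congr rfl fun s _ => by congr 1; omega

/-- The matrix of size `2n` whose rows `2s` and `2s + 1` are the values at `θ_s` of the exponentials
`θ ↦ e^{i x θ}` and of their derivatives `x e^{i x θ}` (up to the factor `i`), the columns being
indexed by the frequencies `x`. -/
def confluentMatrix {n : ℕ} (x : Fin (2 * n) → ℂ) (θ : Fin n → ℝ) :
    Matrix (Fin (2 * n)) (Fin (2 * n)) ℂ :=
  Matrix.of fun i j => (if (i : ℕ) % 2 = 0 then 1 else x j) * exp (I * x j * θ (half i))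

/-- The frequencies `∓(p_s + 1/2)`, with opposite frequencies in adjacent positions. -/
def signedFreq {n : ℕ} (p : Fin n → ℕ) (j : Fin (2 * n)) : ℂ :=
  if (j : ℕ) % 2 = 0 then -((p (half j) : ℂ) + 1 / 2) else (p (half j) : ℂ) + 1 / 2

/-- The confluent determinant with the frequencies `±(p_s + 1/2)`. -/
def pairDet {n : ℕ} (p : Fin n → ℕ) (θ : Fin n → ℝ) : ℂ :=
  (confluentMatrix (signedFreq p) θ).det

/-- The position of the `j`-th entry of `signedFreq` of `0, 1, …, n - 1` when the frequencies
`-(n - 1/2), …, n - 1/2` are put in increasing order. -/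
def sortPerm (n : ℕ) : Equiv.Perm (Fin (2 * n)) :=
  Equiv.ofBijective
    (fun j => ⟨if (j : ℕ) % 2 = 0 then n - 1 - j / 2 else n + j / 2, by split_ifs <;> omega⟩)
    (Finite.injective_iff_bijective.1 fun i j h => by
      simp only [Fin.mk.injEq] at h
      ext
      split_ifs at h <;> omega)

/-- For `|z| = |w| = 1` one has `|z - w| ^ 2 = -(z - w) ^ 2 / (z w)`; this is the square of that
identity. -/
theorem norm_exp_sub_exp_rpow_four (a b : ℝ) :
    ((‖exp (I * a) - exp (I * b)‖ ^ (2 * 2 : ℝ) : ℝ) : ℂ) =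
      (exp (-2 * I * a) * exp (-2 * I * b)) * (exp (I * b) - exp (I * a)) ^ 4 := by
  have h2 : ((‖exp (I * a) - exp (I * b)‖ : ℝ) : ℂ) ^ 2 =
      (exp (-(I * a)) - exp (-(I * b))) * (exp (I * a) - exp (I * b)) := by
    rw [← conj_mul', map_sub, ← exp_conj, ← exp_conj]
    simp
  have h4 : ‖exp (I * a) - exp (I * b)‖ ^ (2 * 2 : ℝ) = (‖exp (I * a) - exp (I * b)‖ ^ 2) ^ 2 := by
    rw [← pow_mul, ← Real.rpow_natCast]
    norm_num
  have hd : ∀ t : ℝ, exp (-2 * I * t) = (exp (I * t))⁻¹ ^ 2 := fun t => by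
    rw [← exp_neg, ← exp_nat_mul]; congr 1; push_cast; ring
  rw [h4, ofReal_pow, ofReal_pow, h2, hd, hd, exp_neg, exp_neg]
  have ha := exp_ne_zero (I * a)
  have hb := exp_ne_zero (I * b)
  field_simp
  ring

/-- The density at `β = 4` is, up to a sign, a confluent Vandermonde determinant in the exponentials
with frequencies `±1/2, …, ±(n - 1/2)`. -/
theorem weight_two_eq {n : ℕ} (θ : Fin n → ℝ) :
    (weight 2 θ : ℂ) =
      ((Equiv.Perm.sign (sortPerm n) : ℤ) : ℂ) * pairDet (fun s : Fin n => (s : ℕ)) θ := by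
  -- the lowest frequency is `-c`; factoring out `e^{-i c θ}` leaves powers of `e^{iθ}`
  let c : ℂ := n - 1 / 2
  have hsort : confluentMatrix (signedFreq fun s : Fin n => (s : ℕ)) θ =
      (confluentMatrix (fun j : Fin (2 * n) => ((j : ℕ) : ℂ) - c) θ).submatrix id (sortPerm n) := by
    have hx : ∀ j, signedFreq (fun s : Fin n => (s : ℕ)) j = ((sortPerm n j : ℕ) : ℂ) - c := by
      intro j
      simp only [signedFreq, half, sortPerm, Equiv.ofBijective_apply, c]
      split_ifs with h
      · rw [Nat.sub_sub, Nat.cast_sub (by omega)]; push_cast; ring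
      · push_cast; ring
    ext i j
    simp [confluentMatrix, hx]
  have hcol : confluentMatrix (fun j : Fin (2 * n) => ((j : ℕ) : ℂ) - c) θ =
      Matrix.of fun i j : Fin (2 * n) => exp (-(I * c * θ (half i))) *
        (Matrix.of fun i j : Fin (2 * n) => (if (i : ℕ) % 2 = 0 then 1 else ((j : ℕ) : ℂ) - c) *
          exp (I * θ (half i)) ^ (j : ℕ)) i j := by
    ext i j
    simp only [confluentMatrix, Matrix.of_apply]
    rw [← exp_nat_mul, mul_left_comm, ← exp_add]
    congr 2
    ring
  have hsgn : ((Equiv.Perm.sign (sortPerm n) : ℤ) : ℂ) *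
      (Equiv.Perm.sign (sortPerm n) : ℤ) = 1 := by
    rw [← Int.cast_mul, ← Units.val_mul, Int.units_mul_self]; simp
  rw [pairDet, hsort, Matrix.det_permute', ← mul_assoc, hsgn, one_mul, hcol, Matrix.det_mul_column,
    det_confluent_vandermonde c fun s => exp (I * θ s), ← mul_assoc, prod_fin_pairs,
    ← Finset.prod_mul_distrib, weight]
  simp only [ofReal_prod, norm_exp_sub_exp_rpow_four]
  rw [show ∀ f g : Fin n → Fin n → ℂ, ∏ i, ∏ j ∈ Finset.Ioi i, f i j * g i j =
      (∏ i, ∏ j ∈ Finset.Ioi i, f i j) * ∏ i, ∏ j ∈ Finset.Ioi i, g i j by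
    simp [Finset.prod_mul_distrib], prod_Ioi_mul fun s => exp (-2 * I * θ s)]
  congr 1
  refine Finset.prod_congr rfl fun s _ => ?_
  rw [half_two_mul, half_two_mul_add_one, ← exp_nat_mul, ← exp_add, ← exp_add,
    Nat.cast_sub (by have := s.2; omega)]
  congr 1
  simp only [c]
  push_cast
  ring

/-! ### Integration of one variable of the determinant -/

/-- Laplace expansion along the last two rows, those of the variable `φ`. -/
theorem det_confluentMatrix_snoc {n : ℕ} (x : Fin (2 * n + 2) → ℂ) (θ : Fin n → ℝ) (φ : ℝ) :
    (confluentMatrix (n := n + 1) x (Fin.snoc θ φ)).det =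
      ∑ j : Fin (2 * n + 2), ∑ k : Fin (2 * n + 1), (-1) ^ (1 + j + k : ℕ) * x j *
        exp (I * (x j + x (j.succAbove k)) * φ) *
          (confluentMatrix (fun i => x (j.succAbove (k.succAbove i))) θ).det := by
  have hodd : ∀ l, confluentMatrix (n := n + 1) x (Fin.snoc θ φ) (Fin.last (2 * n + 1)) l =
      x l * exp (I * x l * φ) := fun l => by
    have : half (n := n + 1) (Fin.last (2 * n + 1)) = Fin.last n := by
      ext; simp only [half, Fin.val_last]; omega
    simp only [confluentMatrix, Matrix.of_apply, this, Fin.snoc_last, Fin.val_last]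
    rw [if_neg (by omega)]
  have heven : ∀ l, confluentMatrix (n := n + 1) x (Fin.snoc θ φ) (Fin.last (2 * n)).castSucc l =
      exp (I * x l * φ) := fun l => by
    have : half (n := n + 1) (Fin.last (2 * n)).castSucc = Fin.last n := by
      ext; simp [half]
    simp [confluentMatrix, this]
  refine (Matrix.det_succ_row (n := 2 * n + 1) _ (Fin.last (2 * n + 1))).trans ?_
  refine Finset.sum_congr rfl fun j _ => ?_
  rw [Matrix.det_succ_row _ (Fin.last (2 * n)), Finset.mul_sum]
  refine Finset.sum_congr rfl fun k _ => ?_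
  have hsub : ((confluentMatrix (n := n + 1) x (Fin.snoc θ φ)).submatrix
      (Fin.last (2 * n + 1)).succAbove j.succAbove).submatrix (Fin.last (2 * n)).succAbove
        k.succAbove = confluentMatrix (fun i => x (j.succAbove (k.succAbove i))) θ := by
    ext a b
    have : half (n := n + 1) a.castSucc.castSucc = (half a).castSucc := rfl
    simp [confluentMatrix, Fin.succAbove_last, this]
  rw [hsub, hodd, Matrix.submatrix_apply, Fin.succAbove_last, heven, Fin.val_last, Fin.val_last,
    mul_add, add_mul, exp_add]
  have h1 : (-1 : ℂ) ^ (2 * n + 1 + j : ℕ) * (-1) ^ (2 * n + k : ℕ) = (-1) ^ (1 + j + k : ℕ) := by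
    rw [← pow_add, show 2 * n + 1 + (j : ℕ) + (2 * n + k) = 2 * (2 * n) + (1 + j + k) by ring,
      pow_add, pow_mul]
    simp
  rw [← h1]
  ring

instance : IsProbabilityMeasure angleMeasure := by
  refine ⟨?_⟩
  have := Real.pi_pos
  simp only [angleMeasure, Measure.smul_apply, Measure.restrict_apply_univ, Real.volume_Ioc,
    sub_zero, smul_eq_mul]
  rw [← ENNReal.ofReal_mul (by positivity), inv_mul_cancel₀ (by positivity), ENNReal.ofReal_one]

theorem integral_exp_angleMeasure (k : ℤ) :
    ∫ θ : ℝ, exp (I * k * θ) ∂angleMeasure = if k = 0 then 1 else 0 := by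
  have hpi := Real.pi_pos
  split_ifs with h
  · simp [h]
  rw [angleMeasure, integral_smul_measure, ← intervalIntegral.integral_of_le (by positivity),
    integral_exp_mul_complex (by simp [I_ne_zero, h])]
  have : exp (I * k * ((2 * Real.pi : ℝ) : ℂ)) = 1 := by
    rw [exp_eq_one_iff]
    exact ⟨k, by push_cast; ring⟩
  rw [this]
  simp

theorem integrable_exp_angleMeasure (a : ℂ) :
    Integrable (fun θ : ℝ => exp (I * a * θ)) angleMeasure := by
  refine Integrable.smul_measure ?_ ENNReal.ofReal_ne_top
  exact (ContinuousOn.integrableOn_Icc (by fun_prop)).mono_set Set.Ioc_subset_Icc_self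

/-- Integration over one variable removes one pair of opposite frequencies: in the Laplace expansion
along the two rows of that variable, a pair of columns survives only if its frequencies add up
to `0`. -/
theorem integral_pairDet_snoc {n : ℕ} (p : Fin (n + 1) → ℕ) (hp : Function.Injective p)
    (θ : Fin n → ℝ) :
    ∫ φ, pairDet p (Fin.snoc θ φ) ∂angleMeasure =
      ∑ s, (2 * p s + 1) * pairDet (p ∘ s.succAbove) θ := by
  let x : Fin (2 * n + 2) → ℂ := signedFreq (n := n + 1) p
  -- twice the frequencies, as integers
  let y : Fin (2 * n + 2) → ℤ := fun j => if (j : ℕ) % 2 = 0 then -(2 * p (half (n := n + 1) j) + 1)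
    else 2 * p (half (n := n + 1) j) + 1
  have hxy : ∀ j, x j = y j / 2 := by
    intro j
    simp only [x, y, signedFreq]
    split_ifs <;> push_cast <;> ring
  have hint : ∀ j l, ∃ m : ℤ, x j + x l = m ∧ (m = 0 ↔ y j + y l = 0) := by
    intro j l
    have : 2 ∣ y j + y l := by simp only [y]; split_ifs <;> omega
    obtain ⟨m, hm⟩ := this
    refine ⟨m, ?_, by omega⟩
    rw [hxy, hxy, ← add_div, ← Int.cast_add, hm]
    push_cast; ring
  have hint' : ∀ j l, ∫ φ : ℝ, exp (I * (x j + x l) * φ) ∂angleMeasure =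
      if y j + y l = 0 then 1 else 0 := by
    intro j l
    obtain ⟨m, hm, hm0⟩ := hint j l
    rw [hm, integral_exp_angleMeasure]
    simp only [hm0]
  have hstep : ∫ φ, pairDet p (Fin.snoc θ φ) ∂angleMeasure =
      ∑ j : Fin (2 * n + 2), ∑ k : Fin (2 * n + 1), (-1) ^ (1 + j + k : ℕ) * x j *
        (if y j + y (j.succAbove k) = 0 then 1 else 0) *
          (confluentMatrix (fun i => x (j.succAbove (k.succAbove i))) θ).det := by
    have h1 : ∀ φ, pairDet p (Fin.snoc θ φ) = _ := fun φ => det_confluentMatrix_snoc x θ φ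
    simp only [h1]
    have hi : ∀ (j : Fin (2 * n + 2)) (k : Fin (2 * n + 1)), Integrable (fun φ : ℝ =>
        (-1) ^ (1 + j + k : ℕ) * x j * exp (I * (x j + x (j.succAbove k)) * φ) *
          (confluentMatrix (fun i => x (j.succAbove (k.succAbove i))) θ).det) angleMeasure :=
      fun j k => ((integrable_exp_angleMeasure _).const_mul _).mul_const _
    rw [integral_finsetSum _ fun j _ => integrable_finsetSum _ fun k _ => hi j k]
    refine Finset.sum_congr rfl fun j _ => ?_
    rw [integral_finsetSum _ fun k _ => hi j k]
    refine Finset.sum_congr rfl fun k _ => ?_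
    rw [integral_mul_const, integral_const_mul, hint']
  rw [hstep]
  refine (sum_fin_pairs (n := n + 1) _).trans (Finset.sum_congr rfl fun s _ => ?_)
  have hs := s.2
  -- both minors left by the columns `2s`, `2s + 1` are the determinant without the pair `s`
  have hminor : ∀ j : Fin (2 * n + 2), (j = ⟨2 * s, by omega⟩ ∨ j = ⟨2 * s + 1, by omega⟩) →
      (fun i => x (j.succAbove ((⟨2 * s, by omega⟩ : Fin (2 * n + 1)).succAbove i))) =
        signedFreq (p ∘ s.succAbove) := by
    intro j hj
    funext i
    have hv : ((j.succAbove ((⟨2 * s, by omega⟩ : Fin (2 * n + 1)).succAbove i) : ℕ)) =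
        if (i : ℕ) < 2 * s then (i : ℕ) else i + 2 := by
      rcases hj with rfl | rfl <;>
      simp only [Fin.succAbove, Fin.lt_def, Fin.val_castSucc] <;>
      split_ifs <;> simp_all <;> omega
    have hh : half (n := n + 1) (j.succAbove
        ((⟨2 * s, by omega⟩ : Fin (2 * n + 1)).succAbove i)) = s.succAbove (half i) := by
      ext
      refine (congrArg (· / 2) hv).trans ?_
      simp only [half, Fin.succAbove, Fin.lt_def, Fin.val_castSucc]
      split_ifs <;> simp <;> omega
    have hm : ((if (i : ℕ) < 2 * s then (i : ℕ) else i + 2) % 2 = 0) = ((i : ℕ) % 2 = 0) := by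
      split_ifs <;> simp
    simp only [x, signedFreq, hh, hv, hm, Function.comp_apply]
  have hyne : ∀ j l : Fin (2 * n + 2), y j + y l = 0 → j ≠ l →
      (j : ℕ) / 2 = l / 2 := by
    intro j l h hjl
    have : p (half (n := n + 1) j) = p (half (n := n + 1) l) := by
      simp only [y] at h
      split_ifs at h <;> omega
    exact congrArg Fin.val (hp this)
  have h2 : half (n := n + 1) ⟨2 * s, by omega⟩ = s := half_two_mul s
  have h3 : half (n := n + 1) ⟨2 * s + 1, by omega⟩ = s := half_two_mul_add_one s
  have he : y ⟨2 * s, by omega⟩ = -(2 * p s + 1) := by simp [y, h2]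
  have ho : y ⟨2 * s + 1, by omega⟩ = 2 * p s + 1 := by simp [y, h3, Nat.add_mod]
  have hse : (⟨2 * s, by omega⟩ : Fin (2 * n + 2)).succAbove
      (⟨2 * s, by omega⟩ : Fin (2 * n + 1)) = ⟨2 * s + 1, by omega⟩ := by
    simp [Fin.succAbove]
  have hso : (⟨2 * s + 1, by omega⟩ : Fin (2 * n + 2)).succAbove
      (⟨2 * s, by omega⟩ : Fin (2 * n + 1)) = ⟨2 * s, by omega⟩ := by
    simp [Fin.succAbove, Fin.lt_def]
  have hzero : ∀ j : Fin (2 * n + 2), (j = ⟨2 * s, by omega⟩ ∨ j = ⟨2 * s + 1, by omega⟩) →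
      ∀ k : Fin (2 * n + 1), k ≠ ⟨2 * s, by omega⟩ → y j + y (j.succAbove k) ≠ 0 := by
    intro j hj k hk h
    have h4 := hyne _ _ h (Fin.succAbove_ne j k).symm
    apply hk
    ext
    rcases hj with rfl | rfl <;>
    simp only [Fin.succAbove, Fin.lt_def, Fin.val_castSucc] at h4 ⊢ <;>
    split_ifs at h4 <;> simp at h4 <;> omega
  rw [Finset.sum_eq_single (⟨2 * s, by omega⟩ : Fin (2 * n + 1)),
    Finset.sum_eq_single (⟨2 * s, by omega⟩ : Fin (2 * n + 1))]
  · rw [hminor _ (Or.inl rfl), hminor _ (Or.inr rfl), hse, hso, hxy, hxy, he, ho,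
      if_pos (by ring), if_pos (by ring), pairDet]
    simp only [pow_add, pow_mul, pow_one]
    push_cast
    ring_nf
  · intro k _ hk
    rw [if_neg (hzero _ (Or.inr rfl) k hk)]
    simp
  · simp
  · intro k _ hk
    rw [if_neg (hzero _ (Or.inl rfl) k hk)]
    simp
  · simp

/-! ### Iterated integrals of the determinant -/

theorem integral_pi_snoc {m : ℕ} {f : (Fin (m + 1) → ℝ) → ℂ}
    (hf : Integrable f (Measure.pi fun _ => angleMeasure)) :
    ∫ φ, f φ ∂(Measure.pi fun _ => angleMeasure) =
      ∫ φ : Fin m → ℝ, ∫ x, f (Fin.snoc φ x) ∂angleMeasure ∂(Measure.pi fun _ => angleMeasure) := by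
  have hmp := (measurePreserving_piFinSuccAbove
    (fun _ : Fin (m + 1) => angleMeasure) (Fin.last m)).symm
  rw [← hmp.integral_comp' f, integral_prod_symm]
  · simp only [MeasurableEquiv.piFinSuccAbove_symm_apply, Fin.insertNthEquiv, Equiv.coe_fn_mk,
      Fin.insertNth_last']
  · exact (hmp.integrable_comp_emb (MeasurableEquiv.measurableEmbedding _)).2 hf

theorem norm_pairDet_le {n : ℕ} (p : Fin n → ℕ) : ∃ B, ∀ θ, ‖pairDet p θ‖ ≤ B := by
  refine ⟨_, fun θ => Matrix.det_le (abv := NormedField.toAbsoluteValue ℂ)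
    (x := 1 + ∑ j, ‖signedFreq p j‖) fun i j => ?_⟩
  obtain ⟨r, hr⟩ : ∃ r : ℝ, signedFreq p j = r := by
    simp only [signedFreq]
    split_ifs
    · exact ⟨-(p (half j) + 1 / 2), by push_cast; ring⟩
    · exact ⟨p (half j) + 1 / 2, by push_cast; ring⟩
  have h1 : ‖exp (I * signedFreq p j * θ (half i))‖ = 1 := by
    rw [hr, show I * (r : ℂ) * (θ (half i) : ℂ) = ((r * θ (half i) : ℝ) : ℂ) * I by
      push_cast; ring, norm_exp_ofReal_mul_I]
  have h2 : ‖signedFreq p j‖ ≤ ∑ j, ‖signedFreq p j‖ :=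
    Finset.single_le_sum (f := fun j => ‖signedFreq p j‖) (fun _ _ => norm_nonneg _)
      (Finset.mem_univ j)
  change ‖_ * exp (I * signedFreq p j * θ (half i))‖ ≤ _
  rw [norm_mul, h1, mul_one]
  split_ifs
  · rw [norm_one]; linarith [norm_nonneg (signedFreq p j)]
  · linarith

theorem continuous_pairDet {n : ℕ} (p : Fin n → ℕ) : Continuous (pairDet p) := by
  refine Continuous.matrix_det (continuous_matrix fun i j => ?_)
  simp only [confluentMatrix, Matrix.of_apply]
  fun_prop

theorem integrable_pairDet_comp {n m : ℕ} (p : Fin n → ℕ) {g : (Fin m → ℝ) → Fin n → ℝ}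
    (hg : Continuous g) :
    Integrable (fun φ => pairDet p (g φ)) (Measure.pi fun _ => angleMeasure) := by
  obtain ⟨B, hB⟩ := norm_pairDet_le p
  exact Integrable.of_bound ((continuous_pairDet p).comp hg).aestronglyMeasurable B
    (Filter.Eventually.of_forall fun φ => hB _)

theorem integral_pairDet {m : ℕ} (p : Fin m → ℕ) (hp : Function.Injective p) :
    ∫ φ, pairDet p φ ∂(Measure.pi fun _ => angleMeasure) =
      m.factorial * ∏ s, (2 * p s + 1 : ℂ) := by
  induction m with
  | zero =>
    rw [Measure.pi_of_empty, integral_dirac]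
    simp [pairDet]
  | succ m ih =>
    have hps : ∀ s : Fin (m + 1), Function.Injective (p ∘ s.succAbove) := fun s =>
      hp.comp Fin.succAbove_right_injective
    rw [integral_pi_snoc (f := pairDet p) (integrable_pairDet_comp p continuous_id)]
    simp only [integral_pairDet_snoc p hp]
    rw [integral_finsetSum _ fun s _ =>
      (integrable_pairDet_comp (p ∘ s.succAbove) continuous_id).const_mul _]
    simp only [integral_const_mul, ih _ (hps _), Function.comp_apply]
    have h : ∀ s : Fin (m + 1), (2 * p s + 1 : ℂ) *
        (m.factorial * ∏ i, (2 * (p (s.succAbove i) : ℂ) + 1)) =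
          m.factorial * ∏ s, (2 * p s + 1 : ℂ) := fun s => by
      rw [Fin.prod_univ_succAbove _ s]; ring
    simp only [h, Finset.sum_const, Finset.card_univ, Fintype.card_fin, nsmul_eq_mul,
      Nat.factorial_succ]
    push_cast
    ring

/-- A family of functions of the frequencies which starts from `pairDet p θ` and obeys the recursion
of `integral_pairDet_snoc` gives the integrals of `pairDet` over all variables but those in `θ`. -/
theorem integral_pairDet_append {n : ℕ} (θ : Fin n → ℝ) (F : ∀ m, (Fin (n + m) → ℕ) → ℂ)
    (h0 : ∀ p : Fin n → ℕ, Function.Injective p → pairDet p θ = F 0 p)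
    (hF : ∀ (m) (p : Fin (n + m + 1) → ℕ), Function.Injective p →
      ∑ s, (2 * p s + 1 : ℂ) * F m (p ∘ s.succAbove) = F (m + 1) p)
    {m : ℕ} (p : Fin (n + m) → ℕ) (hp : Function.Injective p) :
    ∫ φ : Fin m → ℝ, pairDet p (Fin.append θ φ) ∂(Measure.pi fun _ => angleMeasure) = F m p := by
  induction m with
  | zero =>
    rw [Measure.pi_of_empty, integral_dirac, Fin.append_right_nil _ _ rfl]
    exact h0 p hp
  | succ m ih =>
    have hcont : ∀ k, Continuous fun φ : Fin k → ℝ => Fin.append θ φ := fun k =>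
      continuous_pi fun i => by
        refine Fin.addCases (fun i => ?_) (fun i => ?_) i
        · simpa using continuous_const
        · simpa using continuous_apply i
    have hps : ∀ s : Fin (n + m + 1), Function.Injective (p ∘ s.succAbove) := fun s =>
      hp.comp Fin.succAbove_right_injective
    rw [integral_pi_snoc (integrable_pairDet_comp p (hcont _))]
    simp only [Fin.append_snoc]
    have h1 : ∀ φ : Fin m → ℝ, ∫ x, pairDet p (Fin.snoc (Fin.append θ φ) x) ∂angleMeasure = _ :=
      fun φ => integral_pairDet_snoc p hp (Fin.append θ φ)
    simp only [h1]
    rw [integral_finsetSum _ fun s _ =>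
      (integrable_pairDet_comp (p ∘ s.succAbove) (hcont m)).const_mul _]
    simp only [integral_const_mul, ih _ (hps _)]
    exact hF m p hp

theorem integral_pairDet_append_one (θ : ℝ) {m : ℕ} (p : Fin (1 + m) → ℕ)
    (hp : Function.Injective p) :
    ∫ φ : Fin m → ℝ, pairDet p (Fin.append ![θ] φ) ∂(Measure.pi fun _ => angleMeasure) =
      (m + 1).factorial * ∏ s, (2 * p s + 1 : ℂ) := by
  refine integral_pairDet_append ![θ]
    (fun m p => (m + 1).factorial * ∏ s, (2 * p s + 1 : ℂ)) (fun p _ => ?_) (fun m p _ => ?_) p hp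
  · have hdet : pairDet p ![θ] = _ := Matrix.det_fin_two (confluentMatrix (n := 1) _ _)
    have hp1 : ∏ s, (2 * p s + 1 : ℂ) = 2 * p 0 + 1 := Fin.prod_univ_one _
    set a : ℂ := p 0 + 1 / 2 with ha
    have h0 : signedFreq (n := 1) p 0 = -a := by simp [signedFreq, half, ha]
    have h1 : signedFreq (n := 1) p 1 = a := by simp [signedFreq, half, ha]
    have h2a : (2 * p 0 + 1 : ℂ) = 2 * a := by rw [ha]; ring
    have he : exp (-(I * a * θ)) * exp (I * a * θ) = 1 := by
      rw [← exp_add, ← exp_zero]; ring_nf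
    rw [hdet, hp1, h2a]
    simp only [confluentMatrix, Matrix.of_apply, h0, h1]
    simp
    linear_combination 2 * a * he
  · have h : ∀ s : Fin (1 + m + 1), (2 * p s + 1 : ℂ) *
        ((m + 1).factorial * ∏ i, (2 * (p (s.succAbove i) : ℂ) + 1)) =
          (m + 1).factorial * ∏ s, (2 * p s + 1 : ℂ) := fun s => by
      rw [Fin.prod_univ_succAbove _ s]; ring
    simp only [Function.comp_apply, h, Finset.sum_const, Finset.card_univ, Fintype.card_fin,
      nsmul_eq_mul, Nat.factorial_succ (m + 1)]
    rw [← mul_assoc]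
    congr 1
    push_cast
    ring

/-- The contribution of the frequencies `±a`, `±b` to the two-point function at angular distance
`δ`: the determinant of size `4` with these frequencies, divided by `4ab` (`pairDet_two`). -/
def pairTerm (δ : ℝ) (a b : ℂ) : ℂ :=
  (8 * a * b + (a - b) ^ 2 * (exp (I * (a + b) * δ) + exp (-(I * (a + b) * δ))) -
    (a + b) ^ 2 * (exp (I * (a - b) * δ) + exp (-(I * (a - b) * δ)))) / (4 * a * b)

theorem pairTerm_self (δ : ℝ) (a : ℂ) : pairTerm δ a a = 0 := by
  simp only [pairTerm, sub_self, mul_zero, zero_mul, neg_zero, exp_zero]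
  ring

theorem pairTerm_comm (δ : ℝ) (a b : ℂ) : pairTerm δ a b = pairTerm δ b a := by
  simp only [pairTerm]
  rw [show I * (a - b) * (δ : ℂ) = -(I * (b - a) * δ) by ring, neg_neg]
  ring_nf

theorem pairDet_two (θ₁ θ₂ : ℝ) (p : Fin 2 → ℕ) :
    pairDet p ![θ₁, θ₂] =
      (2 * p 0 + 1) * (2 * p 1 + 1) * pairTerm (θ₂ - θ₁) (p 0 + 1 / 2) (p 1 + 1 / 2) := by
  set a : ℂ := p 0 + 1 / 2 with ha
  set b : ℂ := p 1 + 1 / 2 with hb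
  have ha0 : a ≠ 0 := by
    have : a = ((2 * p 0 + 1 : ℕ) : ℂ) / 2 := by rw [ha]; push_cast; ring
    rw [this]; exact div_ne_zero (Nat.cast_ne_zero.2 (by omega)) two_ne_zero
  have hb0 : b ≠ 0 := by
    have : b = ((2 * p 1 + 1 : ℕ) : ℂ) / 2 := by rw [hb]; push_cast; ring
    rw [this]; exact div_ne_zero (Nat.cast_ne_zero.2 (by omega)) two_ne_zero
  have h2a : (2 * p 0 + 1 : ℂ) = 2 * a := by rw [ha]; ring
  have h2b : (2 * p 1 + 1 : ℂ) = 2 * b := by rw [hb]; ring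
  have hR : (2 * a) * (2 * b) * pairTerm (θ₂ - θ₁) a b =
      8 * a * b + (a - b) ^ 2 * (exp (I * (a + b) * (θ₂ - θ₁ : ℝ)) +
        exp (-(I * (a + b) * (θ₂ - θ₁ : ℝ)))) - (a + b) ^ 2 * (exp (I * (a - b) * (θ₂ - θ₁ : ℝ)) +
          exp (-(I * (a - b) * (θ₂ - θ₁ : ℝ)))) := by
    rw [pairTerm, mul_div_assoc', div_eq_iff (by simp [ha0, hb0])]
    ring
  rw [h2a, h2b, hR]
  have h0 : signedFreq p 0 = -a := by simp [signedFreq, half, ha]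
  have h1 : signedFreq p 1 = a := by simp [signedFreq, half, ha]
  have h2 : signedFreq p 2 = -b := by simp [signedFreq, half, hb]
  have h3 : signedFreq p 3 = b := by simp [signedFreq, half, hb]
  have hM : confluentMatrix (signedFreq p) ![θ₁, θ₂] =
      !![exp (-(I * a * θ₁)), exp (I * a * θ₁), exp (-(I * b * θ₁)), exp (I * b * θ₁);
        -a * exp (-(I * a * θ₁)), a * exp (I * a * θ₁), -b * exp (-(I * b * θ₁)),
          b * exp (I * b * θ₁);
        exp (-(I * a * θ₂)), exp (I * a * θ₂), exp (-(I * b * θ₂)), exp (I * b * θ₂);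
        -a * exp (-(I * a * θ₂)), a * exp (I * a * θ₂), -b * exp (-(I * b * θ₂)),
          b * exp (I * b * θ₂)] := by
    have h (i j) : confluentMatrix (signedFreq p) ![θ₁, θ₂] i j =
      (if (i : ℕ) % 2 = 0 then 1 else signedFreq p j) *
        exp (I * signedFreq p j * (![θ₁, θ₂] (half i) : ℝ)) := rfl
    ext i j
    rw [h]
    fin_cases j
    · change (if (i : ℕ) % 2 = 0 then 1 else signedFreq p 0) * exp (I * signedFreq p 0 * _) = _
      rw [h0]
      fin_cases i <;> simp [half]
    · change (if (i : ℕ) % 2 = 0 then 1 else signedFreq p 1) * exp (I * signedFreq p 1 * _) = _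
      rw [h1]
      fin_cases i <;> simp [half]
    · change (if (i : ℕ) % 2 = 0 then 1 else signedFreq p 2) * exp (I * signedFreq p 2 * _) = _
      rw [h2]
      fin_cases i <;> simp [half]
    · change (if (i : ℕ) % 2 = 0 then 1 else signedFreq p 3) * exp (I * signedFreq p 3 * _) = _
      rw [h3]
      fin_cases i <;> simp [half]
  have e1 : exp (I * (a + b) * (θ₂ - θ₁ : ℝ)) = exp (I * a * θ₂) * exp (I * b * θ₂) *
      exp (-(I * a * θ₁)) * exp (-(I * b * θ₁)) := by
    simp only [← exp_add]; congr 1; push_cast; ring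
  have e2 : exp (-(I * (a + b) * (θ₂ - θ₁ : ℝ))) = exp (I * a * θ₁) * exp (I * b * θ₁) *
      exp (-(I * a * θ₂)) * exp (-(I * b * θ₂)) := by
    simp only [← exp_add]; congr 1; push_cast; ring
  have e3 : exp (I * (a - b) * (θ₂ - θ₁ : ℝ)) = exp (I * a * θ₂) * exp (I * b * θ₁) *
      exp (-(I * a * θ₁)) * exp (-(I * b * θ₂)) := by
    simp only [← exp_add]; congr 1; push_cast; ring
  have e4 : exp (-(I * (a - b) * (θ₂ - θ₁ : ℝ))) = exp (I * a * θ₁) * exp (I * b * θ₂) *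
      exp (-(I * a * θ₂)) * exp (-(I * b * θ₁)) := by
    simp only [← exp_add]; congr 1; push_cast; ring
  have e5 : exp (-(I * a * θ₁)) * exp (I * a * θ₁) *
      (exp (-(I * b * θ₂)) * exp (I * b * θ₂)) = 1 := by
    simp only [← exp_add, ← exp_zero]; congr 1; ring
  have e6 : exp (-(I * a * θ₂)) * exp (I * a * θ₂) *
      (exp (-(I * b * θ₁)) * exp (I * b * θ₁)) = 1 := by
    simp only [← exp_add, ← exp_zero]; congr 1; ring
  rw [pairDet, hM, e1, e2, e3, e4]
  refine (Matrix.det_succ_row_zero (n := 3) _).trans ?_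
  simp [Matrix.det_succ_row_zero, Fin.sum_univ_succ, Fin.succAbove]
  linear_combination 4 * a * b * e5 + 4 * a * b * e6

/-! ### The correlation functions -/

/-- If `v` vanishes on the diagonal, each `v s t` with `s ≠ t` is counted once for every index
other than `s` and `t`. -/
theorem sum_sum_succAbove {n : ℕ} (v : Fin (n + 1) → Fin (n + 1) → ℂ) (hv : ∀ s, v s s = 0) :
    ∑ s : Fin (n + 1), ∑ i, ∑ j, v (s.succAbove i) (s.succAbove j) =
      (n - 1) * ∑ s, ∑ t, v s t := by
  have h : ∀ s : Fin (n + 1), ∑ i, ∑ j, v (s.succAbove i) (s.succAbove j) =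
      (∑ a, ∑ b, v a b) - (∑ b, v s b) - ∑ a, v a s := fun s => by
    have h1 : ∀ a, ∑ b, v a b = v a s + ∑ j, v a (s.succAbove j) := fun a =>
      Fin.sum_univ_succAbove _ s
    rw [Fin.sum_univ_succAbove (fun a => ∑ b, v a b) s, Fin.sum_univ_succAbove (fun a => v a s) s]
    simp only [h1, Finset.sum_add_distrib, hv]
    ring
  simp only [h, Finset.sum_sub_distrib, Finset.sum_const, Finset.card_univ, Fintype.card_fin,
    nsmul_eq_mul]
  rw [Finset.sum_comm (f := fun s a => v a s)]
  push_cast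
  ring

theorem integral_pairDet_append_two (θ₁ θ₂ : ℝ) {m : ℕ} (p : Fin (2 + m) → ℕ)
    (hp : Function.Injective p) :
    ∫ φ : Fin m → ℝ, pairDet p (Fin.append ![θ₁, θ₂] φ) ∂(Measure.pi fun _ => angleMeasure) =
      m.factorial * (∏ s, (2 * p s + 1 : ℂ)) *
        (1 / 2 * ∑ s, ∑ t, pairTerm (θ₂ - θ₁) (p s + 1 / 2) (p t + 1 / 2)) := by
  refine integral_pairDet_append ![θ₁, θ₂] (fun m p => m.factorial * (∏ s, (2 * p s + 1 : ℂ)) *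
    (1 / 2 * ∑ s, ∑ t, pairTerm (θ₂ - θ₁) (p s + 1 / 2) (p t + 1 / 2)))
      (fun p _ => ?_) (fun m p _ => ?_) p hp
  · refine (pairDet_two θ₁ θ₂ p).trans ?_
    have h1 : ∏ s, (2 * p s + 1 : ℂ) = _ := Fin.prod_univ_two _
    have h2 : ∀ f : Fin (2 + 0) → ℂ, ∑ s, f s = f 0 + f 1 := fun f => Fin.sum_univ_two f
    rw [h1, h2, h2, h2, pairTerm_self, pairTerm_self, pairTerm_comm _ (p 1 + 1 / 2),
      Nat.factorial_zero]
    push_cast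
    ring
  · have h : ∀ s : Fin (2 + m + 1), (2 * p s + 1 : ℂ) *
        (m.factorial * (∏ i, (2 * ((p ∘ s.succAbove) i : ℂ) + 1)) *
          (1 / 2 * ∑ i, ∑ j, pairTerm (θ₂ - θ₁) ((p ∘ s.succAbove) i + 1 / 2)
            ((p ∘ s.succAbove) j + 1 / 2))) =
          m.factorial * (∏ s, (2 * p s + 1 : ℂ)) * (1 / 2) *
            ∑ i, ∑ j, pairTerm (θ₂ - θ₁) (p (s.succAbove i) + 1 / 2)
              (p (s.succAbove j) + 1 / 2) := fun s => by
      rw [Fin.prod_univ_succAbove _ s]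
      simp only [Function.comp_apply]
      ring
    simp only [h, ← Finset.mul_sum]
    rw [sum_sum_succAbove (fun s t => pairTerm (θ₂ - θ₁) (p s + 1 / 2) (p t + 1 / 2))
      fun s => pairTerm_self _ _, Nat.factorial_succ]
    have key : ∀ P S : ℂ, m.factorial * P * (1 / 2) * (((2 + m : ℕ) - 1) * S) =
        (((m + 1) * m.factorial : ℕ) : ℂ) * P * (1 / 2 * S) := fun P S => by
      push_cast
      ring
    exact key _ _

/-- The constant `Z_N / N!`, namely `1 · 3 ⋯ (2N - 1)`. The sign of `sortPerm` (which must be `1`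
as `Z_N > 0`) is kept as a factor, since it cancels in the correlation functions. -/
def normConst (N : ℕ) : ℂ :=
  ((Equiv.Perm.sign (sortPerm N) : ℤ) : ℂ) * ∏ s ∈ Finset.range N, (2 * s + 1 : ℂ)

theorem normConst_ne_zero (N : ℕ) : normConst N ≠ 0 := by
  refine mul_ne_zero (Int.cast_ne_zero.2 (Units.ne_zero _)) (Finset.prod_ne_zero_iff.2 ?_)
  intro s _
  exact_mod_cast Nat.succ_ne_zero (2 * s)

theorem integral_weight_two {n m : ℕ} (g : (Fin m → ℝ) → Fin n → ℝ) :
    ((∫ φ, weight 2 (g φ) ∂(Measure.pi fun _ => angleMeasure) : ℝ) : ℂ) =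
      ((Equiv.Perm.sign (sortPerm n) : ℤ) : ℂ) *
        ∫ φ, pairDet (fun s : Fin n => (s : ℕ)) (g φ) ∂(Measure.pi fun _ => angleMeasure) := by
  rw [← integral_complex_ofReal]
  simp only [weight_two_eq, integral_const_mul]

theorem partitionFunction_two (N : ℕ) :
    (partitionFunction 2 N : ℂ) = N.factorial * normConst N := by
  rw [partitionFunction, integral_weight_two fun φ => φ, integral_pairDet _ Fin.val_injective,
    normConst, ← Fin.prod_univ_eq_prod_range (fun s => (2 * s + 1 : ℂ))]
  ring

theorem correlation_one {N : ℕ} (hN : 1 ≤ N) (θ : ℝ) : (correlation 2 N ![θ] : ℂ) = N := by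
  have h0 := normConst_ne_zero N
  have h1 : (N.factorial : ℂ) ≠ 0 := Nat.cast_ne_zero.2 N.factorial_ne_zero
  have h2 : ((∫ φ : Fin (N - 1) → ℝ, weight 2 (Fin.append ![θ] φ)
      ∂(Measure.pi fun _ => angleMeasure) : ℝ) : ℂ) = N.factorial * normConst N := by
    rw [integral_weight_two, integral_pairDet_append_one θ _ Fin.val_injective,
      Fin.prod_univ_eq_prod_range (fun s => (2 * s + 1 : ℂ)), mul_left_comm,
      ← normConst, Nat.sub_add_cancel hN]
    congr 2
    omega
  rw [correlation, ofReal_mul, ofReal_div, partitionFunction_two]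
  erw [h2]
  rw [Nat.descFactorial_one, div_mul_cancel₀ _ (mul_ne_zero h1 h0), ofReal_natCast]

theorem correlation_two {N : ℕ} (hN : 1 ≤ N) (θ₁ θ₂ : ℝ) :
    (correlation 2 N ![θ₁, θ₂] : ℂ) = 1 / 2 * ∑ s ∈ Finset.range N, ∑ t ∈ Finset.range N,
      pairTerm (θ₂ - θ₁) (s + 1 / 2) (t + 1 / 2) := by
  obtain rfl | hN2 := hN.eq_or_lt'
  · simp [correlation, pairTerm_self]
  have h0 := normConst_ne_zero N
  have h1 : (N.factorial : ℂ) ≠ 0 := Nat.cast_ne_zero.2 N.factorial_ne_zero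
  have h2 : ((∫ φ : Fin (N - 2) → ℝ, weight 2 (Fin.append ![θ₁, θ₂] φ)
      ∂(Measure.pi fun _ => angleMeasure) : ℝ) : ℂ) = (N - 2).factorial * normConst N *
        (1 / 2 * ∑ s ∈ Finset.range N, ∑ t ∈ Finset.range N,
          pairTerm (θ₂ - θ₁) (s + 1 / 2) (t + 1 / 2)) := by
    have hr : 2 + (N - 2) = N := by omega
    rw [integral_weight_two, integral_pairDet_append_two θ₁ θ₂ _ Fin.val_injective,
      Fin.prod_univ_eq_prod_range (fun s => (2 * s + 1 : ℂ)),
      Fin.sum_univ_eq_sum_range (fun s : ℕ => ∑ t : Fin (2 + (N - 2)),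
        pairTerm (θ₂ - θ₁) (s + 1 / 2) ((t : ℕ) + 1 / 2))]
    simp only [fun a : ℂ => Fin.sum_univ_eq_sum_range (fun t : ℕ =>
      pairTerm (θ₂ - θ₁) a (t + 1 / 2)) (2 + (N - 2))]
    rw [hr, normConst]
    ring
  have h3 : ((N - 2).factorial : ℂ) * N.descFactorial 2 = N.factorial := by
    exact_mod_cast Nat.factorial_mul_descFactorial hN2
  rw [correlation, ofReal_mul, ofReal_div, partitionFunction_two]
  erw [h2]
  rw [ofReal_natCast, div_mul_eq_mul_div, div_eq_iff (mul_ne_zero h1 h0), ← h3]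
  ring

/-! ### Fourier coefficients of the connected two-point function -/

/-- The frequencies `-(N - 1/2), …, N - 1/2` in increasing order. -/
def freq (N l : ℕ) : ℂ := l - N + 1 / 2

theorem freq_ne_zero (N l : ℕ) : freq N l ≠ 0 := by
  intro h
  have : ((2 * l + 1 : ℕ) : ℂ) = ((2 * N : ℕ) : ℂ) := by
    rw [freq] at h
    push_cast
    linear_combination 2 * h
  have := Nat.cast_injective this
  omega

theorem freq_reflect {N l : ℕ} (hl : l < 2 * N) : freq N (2 * N - 1 - l) = -freq N l := by
  rw [freq, freq, Nat.sub_sub, Nat.cast_sub (by omega)]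
  push_cast
  ring

theorem sum_freq {M : Type*} [AddCommMonoid M] (f : ℂ → M) (N : ℕ) :
    ∑ l ∈ Finset.range (2 * N), f (freq N l) =
      ∑ s ∈ Finset.range N, (f (s + 1 / 2) + f (-(s + 1 / 2))) := by
  rw [two_mul, Finset.sum_range_add, add_comm, Finset.sum_add_distrib]
  congr 1
  · refine Finset.sum_congr rfl fun s _ => ?_
    congr 1; rw [freq]; push_cast; ring
  · rw [← Finset.sum_range_reflect]
    refine Finset.sum_congr rfl fun s hs => ?_
    have := Finset.mem_range.1 hs
    congr 1
    rw [freq, Nat.sub_sub, Nat.cast_sub (by omega)]; push_cast; ring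

/-- The coefficient of `e^{i(a + b)(θ₂ - θ₁)}` contributed by the pair of frequencies `(a, b)`. -/
def pairCoeff (a b : ℂ) : ℂ := (a - b) ^ 2 / (8 * a * b)

theorem pairTerm_eq (δ : ℝ) {a b : ℂ} (ha : a ≠ 0) (hb : b ≠ 0) :
    1 / 2 * pairTerm δ a b = 1 +
      (pairCoeff a b * exp (I * (a + b) * δ) + pairCoeff a (-b) * exp (I * (a + -b) * δ) +
        (pairCoeff (-a) b * exp (I * (-a + b) * δ) +
          pairCoeff (-a) (-b) * exp (I * (-a + -b) * δ))) := by
  rw [pairTerm, show I * (-a + -b) * (δ : ℂ) = -(I * (a + b) * δ) by ring,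
    show I * (-a + b) * (δ : ℂ) = -(I * (a - b) * δ) by ring, ← sub_eq_add_neg a b]
  simp only [pairCoeff]
  field_simp
  ring

/-- The connected two-point function as a trigonometric polynomial: the constants in
`pairTerm_eq` cancel the product of the one-point functions. -/
theorem connectedTwoPoint_two {N : ℕ} (hN : 1 ≤ N) (θ₁ θ₂ : ℝ) :
    (connectedTwoPoint 2 N θ₁ θ₂ : ℂ) =
      ∑ l ∈ Finset.range (2 * N), ∑ l' ∈ Finset.range (2 * N),
        pairCoeff (freq N l) (freq N l') *
          exp (I * (freq N l + freq N l') * (θ₂ - θ₁ : ℝ)) := by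
  have hne : ∀ s : ℕ, (s + 1 / 2 : ℂ) ≠ 0 := fun s h => by
    have := freq_ne_zero 0 s
    rw [freq, Nat.cast_zero, sub_zero] at this
    exact this h
  rw [connectedTwoPoint, ofReal_sub, ofReal_mul, correlation_two hN, correlation_one hN,
    correlation_one hN]
  simp only [fun a : ℂ => sum_freq (fun b => pairCoeff a b * exp (I * (a + b) * (θ₂ - θ₁ : ℝ)))]
  rw [sum_freq (fun a => ∑ t ∈ Finset.range N,
    (pairCoeff a (t + 1 / 2) * exp (I * (a + (t + 1 / 2)) * (θ₂ - θ₁ : ℝ)) +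
      pairCoeff a (-(t + 1 / 2)) * exp (I * (a + -(t + 1 / 2)) * (θ₂ - θ₁ : ℝ))))]
  simp only [Finset.mul_sum, pairTerm_eq _ (hne _) (hne _), Finset.sum_add_distrib]
  simp

theorem pairCoeff_eq {a b : ℂ} (ha : a ≠ 0) (hb : b ≠ 0) :
    pairCoeff a b = 1 / 2 * ((a + b) / 4 * (1 / a + 1 / b) - 1) := by
  rw [pairCoeff]
  field_simp
  ring

theorem freq_add_freq (N l l' : ℕ) :
    freq N l + freq N l' = ((l + l' - 2 * N + 1 : ℤ) : ℂ) := by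
  simp only [freq]; push_cast; ring

/-- The `k`-th moment collects the coefficients of the pairs of frequencies with sum `k`. -/
theorem moment_two {N : ℕ} (hN : 1 ≤ N) (k : ℤ) :
    moment 2 N k = ∑ l ∈ Finset.range (2 * N), ∑ l' ∈ Finset.range (2 * N),
      if (l + l' - 2 * N + 1 : ℤ) = k then pairCoeff (freq N l) (freq N l') else 0 := by
  have h : ∀ θ : ℝ, (connectedTwoPoint 2 N 0 θ : ℂ) * exp (-(I * k * θ)) =
      ∑ l ∈ Finset.range (2 * N), ∑ l' ∈ Finset.range (2 * N),
        pairCoeff (freq N l) (freq N l') *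
          exp (I * ((l + l' - 2 * N + 1 - k : ℤ) : ℂ) * θ) := fun θ => by
    simp only [connectedTwoPoint_two hN, Finset.sum_mul, mul_assoc (pairCoeff _ _), ← exp_add,
      freq_add_freq]
    refine Finset.sum_congr rfl fun l _ => Finset.sum_congr rfl fun l' _ => ?_
    congr 2
    push_cast
    ring
  have hi : ∀ l l' : ℕ, Integrable (fun θ : ℝ => pairCoeff (freq N l) (freq N l') *
      exp (I * ((l + l' - 2 * N + 1 - k : ℤ) : ℂ) * θ)) angleMeasure := fun l l' =>
    (integrable_exp_angleMeasure _).const_mul _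
  simp only [moment, h]
  rw [integral_finsetSum _ fun l _ => integrable_finsetSum _ fun l' _ => hi l l']
  refine Finset.sum_congr rfl fun l _ => ?_
  rw [integral_finsetSum _ fun l' _ => hi l l']
  refine Finset.sum_congr rfl fun l' _ => ?_
  rw [integral_const_mul, integral_exp_angleMeasure]
  simp only [sub_eq_zero, mul_ite, mul_one, mul_zero]

theorem hasSum_moment_two {N : ℕ} (hN : 1 ≤ N) (θ₁ θ₂ : ℝ) :
    HasSum (fun k : ℤ => moment 2 N k * exp (I * (k : ℂ) * ((θ₂ - θ₁ : ℝ) : ℂ)))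
      (connectedTwoPoint 2 N θ₁ θ₂ : ℂ) := by
  simp only [connectedTwoPoint_two hN, moment_two hN, Finset.sum_mul, freq_add_freq]
  refine hasSum_sum fun l _ => hasSum_sum fun l' _ => ?_
  convert hasSum_single ((l + l' - 2 * N + 1 : ℤ)) ?_ using 1
  · simp
  · intro k hk
    rw [if_neg hk.symm, zero_mul]

/-- For `k ≥ 0` the pairs of frequencies with sum `k` are those with first entry among the `2N - k`
highest frequencies; exchanging the two entries of a pair is a reflection of that range. -/
theorem moment_two_natCast {N : ℕ} (hN : 1 ≤ N) {k : ℕ} (hk : k ≤ 2 * N) :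
    moment 2 N k = 1 / 2 *
      ((k : ℂ) / 2 * ∑ l ∈ Finset.Ico k (2 * N), 1 / freq N l - (2 * N - k)) := by
  have hrefl : ∑ l ∈ Finset.Ico k (2 * N), 1 / freq N (k + 2 * N - 1 - l) =
      ∑ l ∈ Finset.Ico k (2 * N), 1 / freq N l := by
    have e := Finset.sum_Ico_reflect (fun l => 1 / freq N l) k
      (show 2 * N ≤ k + 2 * N - 1 + 1 by omega)
    rwa [show k + 2 * N - 1 + 1 - 2 * N = k by omega,
      show k + 2 * N - 1 + 1 - k = 2 * N by omega] at e
  have h : ∀ l ∈ Finset.range (2 * N), (∑ l' ∈ Finset.range (2 * N),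
      if (l + l' - 2 * N + 1 : ℤ) = (k : ℤ) then pairCoeff (freq N l) (freq N l') else 0) =
        if k ≤ l then 1 / 2 * ((k : ℂ) / 4 * (1 / freq N l + 1 / freq N (k + 2 * N - 1 - l)) - 1)
          else 0 := by
    intro l hl
    rw [Finset.mem_range] at hl
    split_ifs with hkl
    · rw [Finset.sum_eq_single (k + 2 * N - 1 - l)]
      · have e : ((l : ℤ) + (k + 2 * N - 1 - l : ℕ) - 2 * N + 1 : ℤ) = k := by omega
        rw [if_pos e, pairCoeff_eq (freq_ne_zero _ _) (freq_ne_zero _ _), freq_add_freq, e,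
          Int.cast_natCast]
      · intro l' _ hl'
        exact if_neg (by omega)
      · intro hl'
        rw [Finset.mem_range] at hl'
        omega
    · refine Finset.sum_eq_zero fun l' hl' => if_neg ?_
      rw [Finset.mem_range] at hl'
      omega
  rw [moment_two hN, Finset.sum_congr rfl h, ← Finset.sum_filter]
  have hf : Finset.filter (fun l => k ≤ l) (Finset.range (2 * N)) = Finset.Ico k (2 * N) := by
    ext l; simp only [Finset.mem_filter, Finset.mem_range, Finset.mem_Ico]; omega
  rw [hf, ← Finset.mul_sum, Finset.sum_sub_distrib, ← Finset.mul_sum, Finset.sum_add_distrib, hrefl]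
  simp only [Finset.sum_const, Nat.card_Ico, nsmul_eq_mul, Nat.cast_sub hk]
  push_cast
  ring

theorem moment_two_neg {N : ℕ} (hN : 1 ≤ N) (k : ℤ) : moment 2 N (-k) = moment 2 N k := by
  rw [moment_two hN, moment_two hN, ← Finset.sum_range_reflect]
  refine Finset.sum_congr rfl fun l hl => ?_
  rw [← Finset.sum_range_reflect]
  refine Finset.sum_congr rfl fun l' hl' => ?_
  rw [Finset.mem_range] at hl hl'
  rw [freq_reflect hl, freq_reflect hl']
  refine if_congr (by omega) ?_ rfl
  simp only [pairCoeff]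
  ring

theorem moment_two_eq_zero {N : ℕ} (hN : 1 ≤ N) {k : ℤ} (hk : 2 * (N : ℤ) - 1 ≤ |k|) :
    moment 2 N k = 0 := by
  have h : ∀ k : ℤ, 2 * (N : ℤ) - 1 ≤ k → moment 2 N k = 0 := by
    intro k hk
    rw [moment_two hN]
    refine Finset.sum_eq_zero fun l hl => Finset.sum_eq_zero fun l' hl' => ?_
    rw [Finset.mem_range] at hl hl'
    split_ifs with h
    -- the only pair left is `a = b = N - 1/2`
    · obtain rfl : l = l' := by omega
      simp [pairCoeff]
    · rfl
  rcases le_abs'.1 hk with h' | h'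
  · rw [← neg_neg k, moment_two_neg hN]
    exact h _ (by omega)
  · exact h _ h'

/-! ### Sums of reciprocal frequencies -/

/-- Telescoping of `ψ(z + 1) = ψ(z) + 1 / z`; half-integers are not poles of `ψ`. -/
theorem digamma_freq_sub {N a b : ℕ} (hab : a ≤ b) :
    digamma (freq N b) - digamma (freq N a) = ∑ l ∈ Finset.Ico a b, 1 / freq N l := by
  rw [← Finset.sum_Ico_sub (fun l => digamma (freq N l)) hab]
  refine Finset.sum_congr rfl fun l _ => ?_
  have h : freq N (l + 1) = freq N l + 1 := by simp only [freq]; push_cast; ring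
  rw [h, digamma_apply_add_one, one_div, add_sub_cancel_left]
  intro m hm
  apply freq_ne_zero N (l + m)
  rw [freq] at hm ⊢
  push_cast
  linear_combination hm

/-- The reciprocals of all the frequencies add up to `0`, so the sum over the highest ones is minus
the sum over the `k` lowest ones. -/
theorem sum_Ico_one_div_freq {N k : ℕ} (hk : k ≤ 2 * N) :
    ∑ l ∈ Finset.Ico k (2 * N), 1 / freq N l =
      2 * ∑ j ∈ Finset.Icc 1 k, 1 / (2 * (N : ℂ) - 2 * (j : ℂ) + 1) := by
  have h0 : ∑ l ∈ Finset.range (2 * N), 1 / freq N l = 0 := by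
    rw [sum_freq (fun a => 1 / a)]
    exact Finset.sum_eq_zero fun s _ => by rw [div_neg, add_neg_cancel]
  have h1 := Finset.sum_range_add_sum_Ico (fun l => 1 / freq N l) hk
  have h2 : ∑ l ∈ Finset.range k, 1 / freq N l =
      -(2 * ∑ j ∈ Finset.Icc 1 k, 1 / (2 * (N : ℂ) - 2 * (j : ℂ) + 1)) := by
    rw [← Finset.Ico_add_one_right_eq_Icc, Finset.sum_Ico_eq_sum_range, Nat.add_sub_cancel,
      Finset.mul_sum, ← Finset.sum_neg_distrib]
    refine Finset.sum_congr rfl fun l _ => ?_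
    have : (2 * (N : ℂ) - 2 * ((1 + l : ℕ) : ℂ) + 1) = -2 * freq N l := by
      rw [freq]; push_cast; ring
    rw [this]
    have := freq_ne_zero N l
    field_simp
  rw [h0, h2] at h1
  linear_combination h1

end

end CircularEnsemble

theorem proposition5p1 (N : ℕ) (hN : 1 ≤ N) :
    -- the numbers `m_k` are the coefficients in the expansion of `ρ_{(2)C}` for `β = 4`, `κ = 2`
    (∀ θ₁ θ₂ : ℝ,
      HasSum (fun k : ℤ => CircularEnsemble.moment 2 N k *
          Complex.exp (Complex.I * (k : ℂ) * ((θ₂ - θ₁ : ℝ) : ℂ)))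
        (CircularEnsemble.connectedTwoPoint 2 N θ₁ θ₂ : ℂ)) ∧
    (∀ k : ℤ, |k| ≤ 2 * (N : ℤ) - 2 →
      CircularEnsemble.moment 2 N k =
        -(1 / 2 : ℂ) *
          (if 0 < k then
            2 * (N : ℂ) - (k : ℂ) - (1 / 2 : ℂ) * (k : ℂ) *
              (Complex.digamma ((N : ℂ) + 1 / 2) - Complex.digamma (-(N : ℂ) + (k : ℂ) + 1 / 2))
          else
            2 * (N : ℂ) + (k : ℂ) - (1 / 2 : ℂ) * (k : ℂ) *
              (Complex.digamma ((N : ℂ) + (k : ℂ) + 1 / 2) -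
                Complex.digamma (-(N : ℂ) + 1 / 2)))) ∧
    (∀ k : ℕ, 0 < k → (k : ℤ) ≤ 2 * (N : ℤ) - 2 →
      CircularEnsemble.moment 2 N (k : ℤ) =
        -(N : ℂ) + (k : ℂ) / 2 +
          (k : ℂ) / 2 * ∑ j ∈ Finset.Icc 1 k, 1 / (2 * (N : ℂ) - 2 * (j : ℂ) + 1)) ∧
    (∀ k : ℤ, 2 * (N : ℤ) - 1 ≤ |k| → CircularEnsemble.moment 2 N k = 0) := by
  open CircularEnsemble in
  have hdig : ∀ k : ℕ, (k : ℤ) ≤ 2 * N - 2 → moment 2 N k = -(1 / 2 : ℂ) *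
      (2 * (N : ℂ) - k - 1 / 2 * k *
        (Complex.digamma (N + 1 / 2) - Complex.digamma (-N + k + 1 / 2))) := by
    intro k hk
    have h := digamma_freq_sub (N := N) (show k ≤ 2 * N by omega)
    rw [show freq N (2 * N) = N + 1 / 2 by rw [freq]; push_cast; ring,
      show freq N k = -N + k + 1 / 2 by rw [freq]; ring] at h
    rw [moment_two_natCast hN (by omega), ← h]
    ring
  refine ⟨fun θ₁ θ₂ => hasSum_moment_two hN θ₁ θ₂, fun k hk => ?_,
    fun k _ hk => ?_, fun k hk => moment_two_eq_zero hN hk⟩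
  · split_ifs with h
    · lift k to ℕ using h.le
      exact_mod_cast hdig k (by rwa [Nat.abs_cast] at hk)
    · obtain ⟨m, rfl⟩ : ∃ m : ℕ, k = -m := ⟨k.natAbs, by omega⟩
      rw [abs_neg, Nat.abs_cast] at hk
      -- changing the sign of the frequencies turns the `2N - m` highest ones into the lowest ones,
      -- whose reciprocals give the digamma values of the case `k ≤ 0`
      have hrefl := Finset.sum_Ico_reflect (fun l => 1 / freq N l) m
        (show 2 * N ≤ 2 * N - 1 + 1 by omega)
      rw [show 2 * N - 1 + 1 - 2 * N = 0 by omega, show 2 * N - 1 + 1 - m = 2 * N - m by omega,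
        ← digamma_freq_sub (Nat.zero_le _),
        show freq N 0 = -N + 1 / 2 by rw [freq]; push_cast; ring,
        show freq N (2 * N - m) = N + (-m : ℤ) + 1 / 2 by
          rw [freq, Nat.cast_sub (by omega)]; push_cast; ring,
        Finset.sum_congr rfl fun l hl => by
          rw [freq_reflect (Finset.mem_Ico.1 hl).2, div_neg], Finset.sum_neg_distrib] at hrefl
      rw [moment_two_neg hN, moment_two_natCast hN (by omega), ← hrefl]
      push_cast
      ring
  · rw [moment_two_natCast hN (by omega),
      sum_Ico_one_div_freq (by omega)]
    ring
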